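/- Let $\mathbb{X}$ be a finite set (with all subsets measurable), $\theta>0$, $\nu$ a probability measure on $\mathbb{X}$ with $\nu(\{x\})>0$ for all $x\in\mathbb{X}$, and $R=(R_x)_{x\in\mathbb{X}}$ a family of finite (non-negative) measures on $\mathbb{X}$ such that $\nu(\{x: R_x(\mathbb{X})=0\})=0$ (strictly positive reinforcement). Let $(X_n)_{n\ge1}$ be a measure-valued Pólya sequence with parameters $(\theta,\nu,R)$, i.e. a sequence of $\mathbb{X}$-valued random variables on a probability space $(\Omega,\mathcal{H},\mathbb{P})$ such that $X_1\sim\nu$ and, for every $n\ge1$ and $A\subseteq\mathbb{X}$, almost surely \[ \mathbb{P}(X_{n+1}\in A\mid X_1,\dots,X_n)=\frac{\theta\,\nu(A)+\sum_{i=1}^n R_{X_i}(A)}{\theta+\sum_{i=1}^n R_{X_i}(\mathbb{X})}. \] Then $(X_n)_{n\ge1}$ is conditionally identically distributed, i.e. $(X_1,\dots,X_n,X_{n+1})\overset{d}{=}(X_1,\dots,X_n,X_{n+2})$ for every $n=0,1,2,\dots$, if and only if there exists a partition of $\mathbb{X}$ into non-empty sets $B_1,\dots,B_m$, for some $1\le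 m\le|\mathbb{X}|$, such that 1. for each $j=1,\dots,m$ and all $x\in B_j$, \[\frac{R_x(\cdot)}{R_x(\mathbb{X})}=\nu(\cdot\mid B_j);\] 2. for each $j=1,\dots,m$ and all $a\in(0,\infty)$, \[\nu\bigl(\{y: R_y(\mathbb{X})=a\}\mid B_j\bigr)=\nu\bigl(\{y:R_y(\mathbb{X})=a\}\bigr).\] -/

import Mathlib

open MeasureTheory ProbabilityTheory

namespace PolyaSequence

/-- The vector of the first `n` observations. The sequence is indexed from `0`, so that `X 0`
is the first observation, and `past X n` is `(X 0, …, X (n - 1))`. -/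
def past {Ω E : Type*} (X : ℕ → Ω → E) (n : ℕ) : Ω → (Fin n → E) :=
  fun ω i => X i ω

/-- The `σ`-algebra on `Ω` generated by the first `n` observations. -/
abbrev pastSigma {Ω E : Type*} [MeasurableSpace E] (X : ℕ → Ω → E) (n : ℕ) : MeasurableSpace Ω :=
  MeasurableSpace.comap (past X n) MeasurableSpace.pi

/-- The predictive probability of `A` after the observations `x 0, …, x (n - 1)`:
`(θ ν(A) + ∑ R_{x i}(A)) / (θ + ∑ R_{x i}(E))`. -/
noncomputable def predictive {E : Type*} [MeasurableSpace E] (θ : ℝ) (ν : Measure E)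
    (R : Kernel E E) {n : ℕ} (x : Fin n → E) (A : Set E) : ℝ :=
  (θ * ν.real A + ∑ i, (R (x i)).real A) / (θ + ∑ i, (R (x i)).real Set.univ)

/-- `X` is a measure-valued Pólya sequence with parameters `θ`, `ν`, `R`, under `P`. -/
structure IsMVPS {Ω E : Type*} [MeasurableSpace Ω] [MeasurableSpace E] (P : Measure Ω)
    (X : ℕ → Ω → E) (θ : ℝ) (ν : Measure E) (R : Kernel E E) : Prop where
  theta_pos : 0 < θ
  isProbabilityMeasure : IsProbabilityMeasure ν
  finite_kernel : ∀ x, IsFiniteMeasure (R x)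
  measurable : ∀ n, Measurable (X n)
  map_first : P.map (X 0) = ν
  condProb_next : ∀ n, 1 ≤ n → ∀ A : Set E, MeasurableSet A →
    P⟦X n ⁻¹' A | pastSigma X n⟧ =ᵐ[P] fun ω => predictive θ ν R (past X n ω) A

/-- The reinforcement is strictly positive: `ν` gives no mass to the colours `x` with
`R_x(E) = 0`. -/
def StrictlyPositiveReinforcement {E : Type*} [MeasurableSpace E] (ν : Measure E)
    (R : Kernel E E) : Prop :=
  ν {x | R x Set.univ = 0} = 0

/-- `X` is conditionally identically distributed under `P`: for every `n`, adjoining to the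
first `n` observations either the next one or the one after it gives the same joint law. -/
def IsCID {Ω E : Type*} [MeasurableSpace Ω] [MeasurableSpace E] (P : Measure Ω)
    (X : ℕ → Ω → E) : Prop :=
  ∀ n : ℕ, IdentDistrib (fun ω => (past X n ω, X n ω)) (fun ω => (past X n ω, X (n + 1) ω)) P P

/-- `B` lists the blocks of a partition of `E` into `m` non-empty pairwise disjoint sets. -/
structure IsPartitionInto {E : Type*} {m : ℕ} (B : Fin m → Set E) : Prop where
  nonempty : ∀ j, (B j).Nonempty
  disjoint : ∀ i j, i ≠ j → Disjoint (B i) (B j)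
  cover : ⋃ j, B j = Set.univ

end PolyaSequence

/-! Write `w y` for the total mass of `R y` and `p y` for its normalisation. Every finite path has
positive probability, so the c.i.d. property says exactly that one-step averaging fixes the
predictive law after every path. For an urn of composition `M` and mass `T`, this is the vanishing
of `drift w p M T`.

Necessity: after clearing denominators the drift is polynomial in the colour counts. It vanishes at
natural counts, hence at all real ones (`clearedDrift_eq_zero`). Counts giving `T = -a` and `M = -a
N` isolate the colours of weight `a` (`sum_weight_eq_zero`). Summing over `a` gives `N p = N`: the
case `N = p x` makes `p` idempotent, and `N = ν` makes `ν` stationary. A variance argument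
(`row_eq_of_pos`) then shows that `p` conditions `ν` on the classes of equal rows. The relation for
`N = ν` at a single `a` is independence of weight and class.

Sufficiency: the urn always has a density with respect to `ν` that is constant on blocks, and
independence makes the drift cancel (`drift_eq_zero_of_partition`). -/

namespace PolyaSequence

/-! ### The drift as a polynomial in the colour counts, and its residues. -/

section Algebra

variable {E : Type*} [Fintype E]

/-- The normalised drift, in the direction `z`, of an urn with composition `M` and total mass `T`,
replacement weights `w` and replacement distributions `p`. -/
noncomputable def drift (w : E → ℝ) (p : E → E → ℝ) (M : E → ℝ) (T : ℝ) (z : E) : ℝ :=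
  ∑ y, M y * w y / (T + w y) * (T * p y z - M z)

/-- The drift with all denominators cleared. -/
noncomputable def clearedDrift (w : E → ℝ) (p : E → E → ℝ) (M : E → ℝ) (T : ℝ) (z : E) : ℝ :=
  ∑ y, M y * w y * (∏ b ∈ (Finset.univ.image w).erase (w y), (T + b)) * (T * p y z - M z)

/-- The composition of the urn when each colour `x` has been drawn `k x` times. -/
noncomputable def composition (θ : ℝ) (ν w : E → ℝ) (p : E → E → ℝ) (k : E → ℝ) (z : E) : ℝ :=
  θ * ν z + ∑ x, k x * (w x * p x z)

/-- The total mass of the urn when each colour `x` has been drawn `k x` times. -/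
noncomputable def totalMass (θ : ℝ) (w k : E → ℝ) : ℝ := θ + ∑ x, k x * w x

theorem clearedDrift_eq (w : E → ℝ) (p : E → E → ℝ) (M : E → ℝ) (T : ℝ) (z : E)
    (hT : ∀ y, T + w y ≠ 0) :
    clearedDrift w p M T z = (∏ b ∈ Finset.univ.image w, (T + b)) * drift w p M T z := by
  unfold clearedDrift drift
  rw [Finset.mul_sum]
  refine Finset.sum_congr rfl fun y _ => ?_
  rw [← Finset.mul_prod_erase (Finset.univ.image w) (fun b => T + b)
    (Finset.mem_image_of_mem w (Finset.mem_univ y))]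
  have := hT y
  field_simp

/-- Allows negative and fractional counts, which no path realises but at which the mass can be `-a`.
-/
theorem clearedDrift_eq_zero {θ : ℝ} (hθ : 0 < θ) {ν w : E → ℝ} {p : E → E → ℝ}
    (hw : ∀ x, 0 < w x)
    (h : ∀ (k : E → ℕ) (z : E),
      drift w p (composition θ ν w p fun x => k x) (totalMass θ w fun x => k x) z = 0)
    (k : E → ℝ) (z : E) :
    clearedDrift w p (composition θ ν w p k) (totalMass θ w k) z = 0 := by
  let Mp : E → MvPolynomial E ℝ := fun z =>
    .C (θ * ν z) + ∑ x, .X x * .C (w x * p x z)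
  let Tp : MvPolynomial E ℝ := .C θ + ∑ x, .X x * .C (w x)
  let F : MvPolynomial E ℝ := ∑ y, Mp y * .C (w y) *
    (∏ b ∈ (Finset.univ.image w).erase (w y), (Tp + .C b)) * (Tp * .C (p y z) - Mp z)
  have hF : ∀ k : E → ℝ, MvPolynomial.eval k F =
      clearedDrift w p (composition θ ν w p k) (totalMass θ w k) z := by
    intro k
    simp [F, Mp, Tp, clearedDrift, composition, totalMass, map_sum, map_prod]
  have h0 : F = 0 := by
    -- A polynomial vanishing on a product of infinite sets, here copies of the naturals, is zero.
    refine MvPolynomial.funext_set (fun _ => Set.range ((↑) : ℕ → ℝ))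
      (fun _ => Set.infinite_range_of_injective Nat.cast_injective) fun x hx => ?_
    choose k hk using fun i => hx i (Set.mem_univ i)
    obtain rfl : (fun i => (k i : ℝ)) = x := funext hk
    rw [hF, clearedDrift_eq, h, mul_zero, map_zero]
    intro y
    have : 0 ≤ ∑ x, (k x : ℝ) * w x :=
      Finset.sum_nonneg fun x _ => mul_nonneg (Nat.cast_nonneg _) (hw x).le
    have := hw y
    unfold totalMass
    positivity
  rw [← hF, h0, map_zero]

/-- The distribution `ν` is a mixture of the replacement distributions. -/
theorem exists_mixture {θ : ℝ} (hθ : 0 < θ) {ν w : E → ℝ} {p : E → E → ℝ}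
    (hν : ∀ x, 0 < ν x) (hν1 : ∑ x, ν x = 1) (hw : ∀ x, 0 < w x)
    (h0 : ∀ z, drift w p (fun x => θ * ν x) θ z = 0) :
    ∃ c : E → ℝ, ∑ y, c y = 1 ∧ ∀ z, ν z = ∑ y, c y * p y z := by
  -- These are the coefficients of the drift of the initial urn, up to powers of `θ`.
  let g : E → ℝ := fun y => ν y * w y / (θ + w y)
  have hg : ∀ y, 0 < g y := fun y => by
    have := hν y; have := hw y; positivity
  have hne : (Finset.univ : Finset E).Nonempty := by
    by_contra hc
    rw [Finset.not_nonempty_iff_eq_empty] at hc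
    simp [hc] at hν1
  have hG : 0 < ∑ y, g y := Finset.sum_pos (fun y _ => hg y) hne
  refine ⟨fun y => g y / ∑ y, g y, ?_, fun z => ?_⟩
  · rw [← Finset.sum_div, div_self hG.ne']
  · have h1 : drift w p (fun x => θ * ν x) θ z =
        θ ^ 2 * (∑ y, g y * p y z - (∑ y, g y) * ν z) := by
      unfold drift
      rw [Finset.sum_mul, ← Finset.sum_sub_distrib, Finset.mul_sum]
      refine Finset.sum_congr rfl fun y _ => ?_
      simp only [g]
      ring
    rw [h0 z] at h1
    have h2 : ∑ y, g y * p y z - (∑ y, g y) * ν z = 0 := by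
      have : θ ^ 2 ≠ 0 := by positivity
      simpa [this] using h1.symm
    simp_rw [div_mul_eq_mul_div]
    rw [← Finset.sum_div, eq_div_iff hG.ne']
    linarith

/-- The residue of the drift at `T = -a`: a mixture `N` of replacement distributions is reproduced
by the replacement distributions of the colours of weight `a`. -/
theorem sum_weight_eq_zero {θ : ℝ} (hθ : 0 < θ) {ν w : E → ℝ} {p : E → E → ℝ}
    (hν : ∀ x, 0 < ν x) (hν1 : ∑ x, ν x = 1) (hw : ∀ x, 0 < w x)
    (h : ∀ (k : E → ℕ) (z : E),
      drift w p (composition θ ν w p fun x => k x) (totalMass θ w fun x => k x) z = 0)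
    {d N : E → ℝ} (hd : ∑ y, d y = 1) (hN : ∀ z, N z = ∑ y, d y * p y z) (x z : E) :
    ∑ y with w y = w x, N y * (p y z - N z) = 0 := by
  obtain ⟨c, hc, hcν⟩ := exists_mixture (p := p) hθ hν hν1 hw fun z => by
    have hM : (fun x => θ * ν x) = composition θ ν w p fun _ => 0 := by
      funext x; simp [composition]
    have hT : θ = totalMass θ w fun _ => 0 := by simp [totalMass]
    rw [hM]
    nth_rw 2 [hT]
    exact_mod_cast h (fun _ => 0) z
  let a := w x
  have ha : 0 < a := hw x
  -- The `c` part cancels the initial composition `θ ν`; the `d` part leaves `-a N`, of mass `-a`.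
  let k : E → ℝ := fun y => (-θ * c y - a * d y) / w y
  have hk : ∀ y, k y * w y = -θ * c y - a * d y := fun y => div_mul_cancel₀ _ (hw y).ne'
  have hM : ∀ z, composition θ ν w p k z = -a * N z := by
    intro z
    simp_rw [composition, ← mul_assoc, hk, sub_mul, Finset.sum_sub_distrib, hcν, hN, Finset.mul_sum,
      mul_assoc, neg_mul, Finset.sum_neg_distrib]
    ring
  have hT : totalMass θ w k = -a := by
    simp_rw [totalMass, hk, Finset.sum_sub_distrib, ← Finset.mul_sum, hc, hd]
    ring
  have key := clearedDrift_eq_zero hθ hw h k z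
  rw [hT, clearedDrift] at key
  simp_rw [hM] at key
  rw [← Finset.sum_filter_add_sum_filter_not Finset.univ (fun y => w y = a),
    Finset.sum_eq_zero (s := Finset.univ.filter fun y => ¬ w y = a), add_zero] at key
  · have h1 : ∑ y with w y = a, -a * N y * w y *
        (∏ b ∈ (Finset.univ.image w).erase (w y), (-a + b)) * (-a * p y z - -a * N z) =
        a ^ 3 * (∏ b ∈ (Finset.univ.image w).erase a, (-a + b)) *
          ∑ y with w y = a, N y * (p y z - N z) := by
      rw [Finset.mul_sum]
      refine Finset.sum_congr rfl fun y hy => ?_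
      rw [(Finset.mem_filter.1 hy).2]
      ring
    rw [h1] at key
    refine (mul_eq_zero.1 key).resolve_left (mul_ne_zero (by positivity) ?_)
    refine Finset.prod_ne_zero_iff.2 fun b hb => ?_
    have := (Finset.mem_erase.1 hb).1
    intro h2
    exact this (by linarith)
  · intro y hy
    -- For `w y ≠ a` the product keeps the factor `T + a`, which is zero.
    rw [Finset.prod_eq_zero (i := a), mul_zero, zero_mul]
    · exact Finset.mem_erase.2 ⟨fun h => (Finset.mem_filter.1 hy).2 h.symm,
        Finset.mem_image_of_mem w (Finset.mem_univ x)⟩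
    · simp

theorem sum_mul_eq_of_sum_weight_eq_zero {w N : E → ℝ} {p : E → E → ℝ} {z : E}
    (hN : ∑ y, N y = 1)
    (h : ∀ x, ∑ y with w y = w x, N y * (p y z - N z) = 0) :
    ∑ y, N y * p y z = N z := by
  have h1 : ∑ y, N y * (p y z - N z) = 0 := by
    rw [← Finset.sum_fiberwise_of_maps_to (s := Finset.univ) (t := Finset.univ.image w) (g := w)
      fun y hy => Finset.mem_image_of_mem w hy]
    refine Finset.sum_eq_zero fun a ha => ?_
    obtain ⟨x, -, rfl⟩ := Finset.mem_image.1 ha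
    exact h x
  simp_rw [mul_sub, Finset.sum_sub_distrib, ← Finset.sum_mul, hN, one_mul] at h1
  linarith

/-! ### Idempotent stochastic matrices. -/

/-- An idempotent stochastic matrix with a stationary distribution of full support is constant
along its transitions. -/
theorem row_eq_of_pos {ν : E → ℝ} {p : E → E → ℝ} (hν : ∀ x, 0 < ν x) (hp : ∀ x y, 0 ≤ p x y)
    (hp1 : ∀ x, ∑ y, p x y = 1) (hpp : ∀ x z, ∑ y, p x y * p y z = p x z)
    (hνp : ∀ z, ∑ y, ν y * p y z = ν z) {x y : E} (hxy : 0 < p x y) : p x = p y := by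
  funext z
  -- By idempotence `p x z` is the mean of `p y z` under `p x`, so the inner sum is `ν x` times a
  -- variance. By stationarity the second moments cancel after summing over `x`.
  have h0 : ∑ x, ∑ y, ν x * p x y * (p x z - p y z) ^ 2 = 0 := by
    have e1 : ∀ x, ∑ y, ν x * p x y * (p x z - p y z) ^ 2 =
        ∑ y, ν x * p x y * p y z ^ 2 - ν x * p x z ^ 2 := by
      intro x
      have : ∀ y, ν x * p x y * (p x z - p y z) ^ 2 = ν x * p x z ^ 2 * p x y
          - 2 * ν x * p x z * (p x y * p y z) + ν x * p x y * p y z ^ 2 := fun y => by ring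
      simp_rw [this, Finset.sum_add_distrib, Finset.sum_sub_distrib, ← Finset.mul_sum, hp1, hpp]
      ring
    simp_rw [e1, Finset.sum_sub_distrib]
    rw [Finset.sum_comm]
    simp_rw [← Finset.sum_mul, hνp, sub_self]
  have hnn : ∀ x y, 0 ≤ ν x * p x y * (p x z - p y z) ^ 2 := fun x y =>
    mul_nonneg (mul_nonneg (hν x).le (hp x y)) (sq_nonneg _)
  have h1 := (Finset.sum_eq_zero_iff_of_nonneg fun x _ => Finset.sum_nonneg fun y _ => hnn x y).1
    h0 x (Finset.mem_univ x)
  have h2 := (Finset.sum_eq_zero_iff_of_nonneg fun y _ => hnn x y).1 h1 y (Finset.mem_univ y)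
  have h3 : ν x * p x y ≠ 0 := (mul_pos (hν x) hxy).ne'
  have h4 := (mul_eq_zero.1 h2).resolve_left h3
  exact sub_eq_zero.1 (pow_eq_zero_iff two_ne_zero |>.1 h4)

theorem row_eq_zero_of_ne {ν : E → ℝ} {p : E → E → ℝ} (hν : ∀ x, 0 < ν x) (hp : ∀ x y, 0 ≤ p x y)
    (hp1 : ∀ x, ∑ y, p x y = 1) (hpp : ∀ x z, ∑ y, p x y * p y z = p x z)
    (hνp : ∀ z, ∑ y, ν y * p y z = ν z) {x y : E} (hxy : p x ≠ p y) : p x y = 0 := by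
  by_contra hne
  exact hxy (row_eq_of_pos hν hp hp1 hpp hνp (lt_of_le_of_ne (hp x y) (Ne.symm hne)))

/-- An idempotent stochastic matrix with a stationary distribution `ν` of full support is
conditioning of `ν` on the classes of equal rows. -/
theorem sum_class_mul_row {ν : E → ℝ} {p : E → E → ℝ} (hν : ∀ x, 0 < ν x)
    (hp : ∀ x y, 0 ≤ p x y)
    (hp1 : ∀ x, ∑ y, p x y = 1) (hpp : ∀ x z, ∑ y, p x y * p y z = p x z)
    (hνp : ∀ z, ∑ y, ν y * p y z = ν z) {x z : E} (hxz : p x = p z) :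
    (∑ y with p y = p z, ν y) * p x z = ν z := by
  rw [hxz, ← hνp z, Finset.sum_mul, Finset.sum_filter]
  refine Finset.sum_congr rfl fun y _ => ?_
  split_ifs with h
  · rw [h]
  · rw [row_eq_zero_of_ne hν hp hp1 hpp hνp h, mul_zero]

/-- Only the class of `z` contributes to `∑ ν y * p y z`, each time with the factor `p z z`. Since
`ν z` is the class mass times `p z z`, this factor cancels. -/
theorem weight_indep_class {ν w : E → ℝ} {p : E → E → ℝ} (hν : ∀ x, 0 < ν x)
    (hp : ∀ x y, 0 ≤ p x y)
    (hp1 : ∀ x, ∑ y, p x y = 1) (hpp : ∀ x z, ∑ y, p x y * p y z = p x z)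
    (hνp : ∀ z, ∑ y, ν y * p y z = ν z) (a : ℝ) (z : E)
    (h : ∑ y with w y = a, ν y * (p y z - ν z) = 0) :
    ∑ y with p y = p z ∧ w y = a, ν y = (∑ y with p y = p z, ν y) * ∑ y with w y = a, ν y := by
  have hz : (∑ y with p y = p z, ν y) * p z z = ν z := sum_class_mul_row hν hp hp1 hpp hνp rfl
  have hpz : p z z ≠ 0 := fun h => by
    rw [h, mul_zero] at hz; exact (hν z).ne hz
  have h1 : ∑ y with w y = a, ν y * p y z = (∑ y with p y = p z ∧ w y = a, ν y) * p z z := by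
    rw [Finset.sum_mul, Finset.sum_filter, Finset.sum_filter]
    refine Finset.sum_congr rfl fun y _ => ?_
    by_cases hy : p y = p z
    · simp [hy]
    · simp [hy, row_eq_zero_of_ne hν hp hp1 hpp hνp hy]
  simp_rw [mul_sub, Finset.sum_sub_distrib, ← Finset.sum_mul, h1] at h
  apply mul_right_cancel₀ hpz
  linear_combination h - (∑ y with w y = a, ν y) * hz

/-! ### Zero drift from a partition, and its link with one-step averaging. -/

/-- The drift of the urn vanishes when replacement is conditioning of `ν` on the blocks of a
partition, given by a labelling `b`, which is independent of the weights under `ν`. -/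
theorem drift_eq_zero_of_partition {ι : Type*} [Fintype ι] [DecidableEq ι] (b : E → ι) {θ : ℝ}
    {ν w : E → ℝ} {p : E → E → ℝ} (hν : ∀ x, 0 < ν x) (hν1 : ∑ x, ν x = 1)
    (hpb : ∀ x z, p x z = if b x = b z then ν z / ∑ y with b y = b z, ν y else 0)
    (hind : ∀ j a, ∑ y with b y = j ∧ w y = a, ν y =
      (∑ y with b y = j, ν y) * ∑ y with w y = a, ν y)
    {n : ℕ} (x : Fin n → E) (z : E) :
    drift w p (fun z => θ * ν z + ∑ i, w (x i) * p (x i) z) (θ + ∑ i, w (x i)) z = 0 := by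
  set T := θ + ∑ i, w (x i) with hT
  let β : ι → ℝ := fun j => ∑ y with b y = j, ν y
  have hβ : ∀ y, β (b y) ≠ 0 := fun y =>
    (Finset.sum_pos (fun y _ => hν y) ⟨y, by simp⟩).ne'
  -- The density of the urn with respect to `ν` on block `j`.
  let c : ι → ℝ := fun j => θ + ∑ i, if b (x i) = j then w (x i) / β j else 0
  have hM : ∀ y, θ * ν y + ∑ i, w (x i) * p (x i) y = ν y * c (b y) := by
    intro y
    simp only [c, mul_add, Finset.mul_sum, hpb]
    congr 1
    · ring
    · refine Finset.sum_congr rfl fun i _ => ?_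
      split_ifs
      · simp only [β]; ring
      · simp
  have hp1 : ∀ x, ∑ z, p x z = 1 := by
    intro x
    simp_rw [hpb]
    rw [← Finset.sum_filter, Finset.sum_congr rfl (g := fun z => ν z / β (b x))]
    · rw [← Finset.sum_div, div_eq_one_iff_eq (hβ x)]
      simp only [β, eq_comm]
    · intro z hz
      rw [(Finset.mem_filter.1 hz).2]
  have hMT : ∑ y, ν y * c (b y) = T := by
    simp_rw [← hM, Finset.sum_add_distrib, ← Finset.mul_sum, hν1]
    rw [Finset.sum_comm]
    simp_rw [← Finset.mul_sum, hp1, mul_one]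
    exact hT.symm
  let g : ℝ → ℝ := fun a => a / (T + a)
  -- Independence of block and weight extends from level sets to the function `g` of the weight.
  have hg : ∀ j, ∑ y with b y = j, ν y * g (w y) = β j * ∑ y, ν y * g (w y) := by
    intro j
    rw [← Finset.sum_fiberwise_of_maps_to (s := Finset.univ) (t := Finset.univ.image w) (g := w)
      fun y hy => Finset.mem_image_of_mem w hy,
      ← Finset.sum_fiberwise_of_maps_to (s := Finset.univ.filter fun y => b y = j)
      (t := Finset.univ.image w) (g := w)
      fun y hy => Finset.mem_image_of_mem w (Finset.mem_univ y), Finset.mul_sum]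
    refine Finset.sum_congr rfl fun a _ => ?_
    rw [Finset.sum_congr rfl (g := fun y => ν y * g a),
      Finset.sum_congr (s₁ := Finset.univ.filter fun y => w y = a) rfl (g := fun y => ν y * g a),
      ← Finset.sum_mul, ← Finset.sum_mul, Finset.filter_filter, hind, mul_assoc]
    · intro y hy
      rw [(Finset.mem_filter.1 hy).2]
    · intro y hy
      rw [(Finset.mem_filter.1 hy).2]
  set G := ∑ y, ν y * g (w y) with hG
  have h1 : ∑ y, ν y * c (b y) * g (w y) * p y z = ν z * c (b z) * G := by
    have : ∀ y, ν y * c (b y) * g (w y) * p y z =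
        if b y = b z then (ν y * g (w y)) * (c (b z) * ν z / β (b z)) else 0 := by
      intro y
      rw [hpb]
      split_ifs with h
      · rw [h]; simp only [β]; ring
      · simp
    simp_rw [this]
    rw [← Finset.sum_filter, ← Finset.sum_mul, hg]
    have := hβ z
    field_simp
  have h2 : ∑ y, ν y * c (b y) * g (w y) = T * G := by
    rw [← hMT, ← Finset.sum_fiberwise (s := Finset.univ) (g := b),
      ← Finset.sum_fiberwise (s := Finset.univ) (g := b) (f := fun y => ν y * c (b y)),
      Finset.sum_mul]
    refine Finset.sum_congr rfl fun j _ => ?_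
    rw [Finset.sum_congr rfl (g := fun y => ν y * g (w y) * c j),
      Finset.sum_congr rfl (g := fun y => ν y * c j) (f := fun y => ν y * c (b y)),
      ← Finset.sum_mul, ← Finset.sum_mul, hg]
    · simp only [β]; ring
    · intro y hy
      rw [(Finset.mem_filter.1 hy).2]
    · intro y hy
      rw [(Finset.mem_filter.1 hy).2]; ring
  unfold drift
  simp_rw [hM]
  calc ∑ y, ν y * c (b y) * w y / (T + w y) * (T * p y z - ν z * c (b z))
      = ∑ y, (T * (ν y * c (b y) * g (w y) * p y z)
          - ν y * c (b y) * g (w y) * (ν z * c (b z))) :=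
        Finset.sum_congr rfl fun y _ => by simp only [g]; ring
    _ = 0 := by
        rw [Finset.sum_sub_distrib, ← Finset.mul_sum, ← Finset.sum_mul, h1, h2]
        ring

/-- Vanishing drift says that the predictive distribution is a fixed point of one-step
averaging. -/
theorem drift_eq_zero_iff {w : E → ℝ} {p : E → E → ℝ} {M : E → ℝ} {T : ℝ} (hT : 0 < T)
    (hw : ∀ x, 0 < w x) (hM : ∑ y, M y = T) (z : E) :
    drift w p M T z = 0 ↔
      M z / T = ∑ y, M y / T * ((M z + w y * p y z) / (T + w y)) := by
  have h1 : drift w p M T z = T ^ 2 *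
      (∑ y, M y / T * ((M z + w y * p y z) / (T + w y)) - M z / T) := by
    have h2 : M z / T = ∑ y, M y / T * (M z / T) := by
      rw [← Finset.sum_mul, ← Finset.sum_div, hM, div_self hT.ne', one_mul]
    rw [h2, ← Finset.sum_sub_distrib, Finset.mul_sum]
    refine Finset.sum_congr rfl fun y _ => ?_
    have : T + w y ≠ 0 := (add_pos hT (hw y)).ne'
    field_simp
    ring
  rw [h1, mul_eq_zero, or_iff_right (by positivity), sub_eq_zero, eq_comm]

/-- The urn depends on a path only through its counts, and every count vector is attained. -/
theorem exists_path (k : E → ℕ) :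
    ∃ (n : ℕ) (x : Fin n → E), ∀ f : E → ℝ, ∑ i, f (x i) = ∑ e, (k e : ℝ) * f e := by
  refine ⟨_, fun i => ((Fintype.equivFin (Σ e, Fin (k e))).symm i).1, fun f => ?_⟩
  rw [Equiv.sum_comp (Fintype.equivFin (Σ e, Fin (k e))).symm (fun s => f s.1),
    Fintype.sum_sigma]
  simp

end Algebra

/-! ### The joint laws of the sequence. -/

theorem past_succ_preimage {Ω E : Type*} (X : ℕ → Ω → E) {n : ℕ} (x : Fin n → E) (y : E) :
    past X (n + 1) ⁻¹' {Fin.snoc x y} = past X n ⁻¹' {x} ∩ X n ⁻¹' {y} := by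
  ext ω
  have : past X (n + 1) ω = Fin.snoc (past X n ω) (X n ω) := by
    funext i
    refine Fin.lastCases ?_ (fun i => ?_) i <;> simp [past]
  simp [this, Fin.snoc_inj]

section Law

variable {Ω E : Type*} [MeasurableSpace Ω] [MeasurableSpace E]

theorem measurable_past {X : ℕ → Ω → E} (hX : ∀ n, Measurable (X n)) (n : ℕ) :
    Measurable (past X n) :=
  measurable_pi_lambda _ fun i => hX i

theorem predictive_zero {θ : ℝ} (hθ : 0 < θ) (ν : Measure E) (R : Kernel E E) (x : Fin 0 → E)
    (A : Set E) : predictive θ ν R x A = ν.real A := by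
  simp [predictive, hθ.ne']

theorem predictive_pos {θ : ℝ} (hθ : 0 < θ) {ν : Measure E} [IsFiniteMeasure ν]
    (R : Kernel E E) (hν : ∀ x, 0 < ν {x}) {n : ℕ} (x : Fin n → E) (y : E) :
    0 < predictive θ ν R x {y} := by
  have h1 : 0 < ν.real {y} := ENNReal.toReal_pos (hν y).ne' (measure_ne_top _ _)
  have h2 : 0 ≤ ∑ i, (R (x i)).real {y} := Finset.sum_nonneg fun _ _ => measureReal_nonneg
  have h3 : 0 ≤ ∑ i, (R (x i)).real Set.univ := Finset.sum_nonneg fun _ _ => measureReal_nonneg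
  unfold predictive
  positivity

/-- The replacement distribution of the colour `x`, as a matrix. -/
noncomputable def replacement (R : Kernel E E) (x z : E) : ℝ :=
  (R x).real {z} / (R x).real Set.univ

theorem predictive_snoc (θ : ℝ) (ν : Measure E) (R : Kernel E E)
    (hw : ∀ x, 0 < (R x).real Set.univ) {n : ℕ} (x : Fin n → E) (y z : E) :
    predictive θ ν R (Fin.snoc x y : Fin (n + 1) → E) {z} =
      ((θ * ν.real {z} + ∑ i, (R (x i)).real {z})
        + (R y).real Set.univ * replacement R y z) /
      ((θ + ∑ i, (R (x i)).real Set.univ) + (R y).real Set.univ) := by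
  rw [replacement, mul_div_cancel₀ _ (hw y).ne']
  simp [predictive, Fin.sum_univ_castSucc, add_assoc]

variable [MeasurableSingletonClass E]

theorem IsMVPS.measureReal_inter {P : Measure Ω} [IsProbabilityMeasure P] {X : ℕ → Ω → E} {θ : ℝ}
    {ν : Measure E} {R : Kernel E E} (hX : IsMVPS P X θ ν R) {n : ℕ} (x : Fin n → E) {A : Set E}
    (hA : MeasurableSet A) :
    P.real (past X n ⁻¹' {x} ∩ X n ⁻¹' A) = P.real (past X n ⁻¹' {x}) * predictive θ ν R x A := by
  -- The conditional law is prescribed only for `1 ≤ n`; the empty path uses the law of `X 0`.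
  rcases Nat.eq_zero_or_pos n with rfl | hn
  · rw [predictive_zero hX.theta_pos, ← hX.map_first, map_measureReal_apply (hX.measurable 0) hA]
    have : past X 0 ⁻¹' {x} = Set.univ := by
      ext ω; simp [Subsingleton.elim (past X 0 ω) x]
    simp [this]
  · have hm : pastSigma X n ≤ ‹MeasurableSpace Ω› := (measurable_past hX.measurable n).comap_le
    have hs : MeasurableSet[pastSigma X n] (past X n ⁻¹' {x}) :=
      ⟨{x}, measurableSet_singleton x, rfl⟩
    have hXA : MeasurableSet (X n ⁻¹' A) := hX.measurable n hA
    have h1 := setIntegral_condExp (μ := P) hm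
      (f := (X n ⁻¹' A).indicator fun _ => (1 : ℝ))
      ((integrable_const (1 : ℝ)).indicator hXA) hs
    rw [setIntegral_congr_ae (g := fun _ => predictive θ ν R x A) (hm _ hs)] at h1
    · rw [setIntegral_indicator hXA] at h1
      simpa using h1.symm
    · filter_upwards [hX.condProb_next n hn A hA] with ω hω hωx
      rw [hω, Set.mem_singleton_iff.1 hωx]

theorem IsMVPS.measureReal_past_succ {P : Measure Ω} [IsProbabilityMeasure P] {X : ℕ → Ω → E}
    {θ : ℝ} {ν : Measure E} {R : Kernel E E} (hX : IsMVPS P X θ ν R) {n : ℕ} (x : Fin n → E)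
    (y : E) :
    P.real (past X (n + 1) ⁻¹' {Fin.snoc x y}) =
      P.real (past X n ⁻¹' {x}) * predictive θ ν R x {y} := by
  rw [past_succ_preimage, hX.measureReal_inter x (measurableSet_singleton y)]

theorem IsMVPS.measureReal_past_pos {P : Measure Ω} [IsProbabilityMeasure P] {X : ℕ → Ω → E}
    {θ : ℝ} {ν : Measure E} {R : Kernel E E} (hX : IsMVPS P X θ ν R) (hν : ∀ x, 0 < ν {x})
    {n : ℕ} (x : Fin n → E) : 0 < P.real (past X n ⁻¹' {x}) := by
  have := hX.isProbabilityMeasure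
  induction n with
  | zero =>
    have : past X 0 ⁻¹' {x} = Set.univ := by
      ext ω; simp [Subsingleton.elim (past X 0 ω) x]
    simp [this]
  | succ n ih =>
    rw [← Fin.snoc_init_self x, hX.measureReal_past_succ]
    exact mul_pos (ih _) (predictive_pos hX.theta_pos R hν _ _)

theorem map_pair_apply_singleton {P : Measure Ω} [IsProbabilityMeasure P] {X : ℕ → Ω → E}
    (hX : ∀ n, Measurable (X n)) (n m : ℕ) (x : Fin n → E) (z : E) :
    P.map (fun ω => (past X n ω, X m ω)) {(x, z)} =
      ENNReal.ofReal (P.real (past X n ⁻¹' {x} ∩ X m ⁻¹' {z})) := by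
  rw [Measure.map_apply ((measurable_past hX n).prodMk (hX m)) (measurableSet_singleton _),
    ofReal_measureReal]
  congr 1
  ext ω
  simp

variable [Fintype E]

theorem IsMVPS.measureReal_inter_succ {P : Measure Ω} [IsProbabilityMeasure P] {X : ℕ → Ω → E}
    {θ : ℝ} {ν : Measure E} {R : Kernel E E} (hX : IsMVPS P X θ ν R) {n : ℕ} (x : Fin n → E)
    (z : E) :
    P.real (past X n ⁻¹' {x} ∩ X (n + 1) ⁻¹' {z}) = P.real (past X n ⁻¹' {x}) *
      ∑ y, predictive θ ν R x {y} * predictive θ ν R (Fin.snoc x y : Fin (n + 1) → E) {z} := by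
  have h1 := sum_measureReal_preimage_singleton (μ := P.restrict
    (past X n ⁻¹' {x} ∩ X (n + 1) ⁻¹' {z})) Finset.univ (f := X n)
    (fun y _ => hX.measurable n (measurableSet_singleton y))
  rw [Finset.coe_univ, Set.preimage_univ, measureReal_restrict_apply_univ] at h1
  rw [← h1, Finset.mul_sum]
  refine Finset.sum_congr rfl fun y _ => ?_
  rw [measureReal_restrict_apply (hX.measurable n (measurableSet_singleton y)), ← mul_assoc,
    ← hX.measureReal_past_succ, ← hX.measureReal_inter _ (measurableSet_singleton z),
    past_succ_preimage]
  congr 1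
  ext ω
  simp only [Set.mem_inter_iff]
  tauto

/-- A Pólya sequence is conditionally identically distributed iff its predictive distributions
are fixed points of one-step averaging, along all paths. -/
theorem IsMVPS.isCID_iff {P : Measure Ω} [IsProbabilityMeasure P] {X : ℕ → Ω → E}
    {θ : ℝ} {ν : Measure E} {R : Kernel E E} (hX : IsMVPS P X θ ν R) (hν : ∀ x, 0 < ν {x}) :
    IsCID P X ↔ ∀ (n : ℕ) (x : Fin n → E) (z : E), predictive θ ν R x {z} =
      ∑ y, predictive θ ν R x {y} * predictive θ ν R (Fin.snoc x y : Fin (n + 1) → E) {z} := by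
  have hpair (n m : ℕ) : Measurable fun ω => (past X n ω, X m ω) :=
    (measurable_past hX.measurable n).prodMk (hX.measurable m)
  refine forall_congr' fun n => ?_
  have h1 : IdentDistrib (fun ω => (past X n ω, X n ω)) (fun ω => (past X n ω, X (n + 1) ω)) P P ↔
      P.map (fun ω => (past X n ω, X n ω)) = P.map (fun ω => (past X n ω, X (n + 1) ω)) :=
    ⟨fun h => h.map_eq, fun h => ⟨(hpair _ _).aemeasurable, (hpair _ _).aemeasurable, h⟩⟩
  rw [h1, Measure.ext_iff_singleton, Prod.forall]
  refine forall_congr' fun x => forall_congr' fun z => ?_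
  -- Both joint probabilities contain the probability of the path, which is positive and cancels.
  rw [map_pair_apply_singleton hX.measurable, map_pair_apply_singleton hX.measurable,
    ENNReal.ofReal_eq_ofReal_iff measureReal_nonneg measureReal_nonneg,
    hX.measureReal_inter x (measurableSet_singleton z), hX.measureReal_inter_succ,
    mul_right_inj' (hX.measureReal_past_pos hν x).ne']

theorem IsMVPS.isCID_iff_drift {P : Measure Ω} [IsProbabilityMeasure P] {X : ℕ → Ω → E}
    {θ : ℝ} {ν : Measure E} {R : Kernel E E} (hX : IsMVPS P X θ ν R) (hν : ∀ x, 0 < ν {x})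
    (hw : ∀ x, 0 < (R x).real Set.univ) :
    IsCID P X ↔ ∀ (n : ℕ) (x : Fin n → E) (z : E),
      drift (fun y => (R y).real Set.univ) (replacement R)
        (fun z => θ * ν.real {z} + ∑ i, (R (x i)).real Set.univ * replacement R (x i) z)
        (θ + ∑ i, (R (x i)).real Set.univ) z = 0 := by
  have := hX.isProbabilityMeasure
  have := hX.finite_kernel
  rw [hX.isCID_iff hν]
  refine forall_congr' fun n => forall_congr' fun x => forall_congr' fun z => ?_
  have hM : ∀ z, θ * ν.real {z} + ∑ i, (R (x i)).real Set.univ * replacement R (x i) z =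
      θ * ν.real {z} + ∑ i, (R (x i)).real {z} := by
    intro z
    simp_rw [replacement, mul_div_cancel₀ _ (hw _).ne']
  have htot : ∀ (μ : Measure E) [IsFiniteMeasure μ], ∑ z, μ.real {z} = μ.real Set.univ := by
    intro μ _
    simp
  rw [drift_eq_zero_iff (add_pos_of_pos_of_nonneg hX.theta_pos
    (Finset.sum_nonneg fun i _ => (hw _).le)) hw]
  · simp_rw [hM, predictive_snoc θ ν R hw]
    rfl
  · simp_rw [hM, Finset.sum_add_distrib, ← Finset.mul_sum, htot ν, probReal_univ, mul_one]
    rw [Finset.sum_comm]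
    simp_rw [htot]

end Law

/-! ### Conditional measures in terms of point masses. -/

section Main

variable {E : Type*} [MeasurableSpace E]

theorem StrictlyPositiveReinforcement.total_pos {ν : Measure E} {R : Kernel E E}
    (hR : StrictlyPositiveReinforcement ν R) (hν : ∀ x, 0 < ν {x})
    (hfin : ∀ x, IsFiniteMeasure (R x)) (x : E) : 0 < (R x).real Set.univ := by
  refine ENNReal.toReal_pos (fun h => (hν x).ne' ?_) (measure_ne_top _ _)
  exact measure_mono_null (Set.singleton_subset_iff.2 h) hR

theorem measureReal_pos_of_nonempty {ν : Measure E} [IsFiniteMeasure ν] (hν : ∀ x, 0 < ν {x})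
    {B : Set E} (hB : B.Nonempty) : 0 < ν.real B := by
  obtain ⟨x, hx⟩ := hB
  exact ENNReal.toReal_pos ((hν x).trans_le (measure_mono (Set.singleton_subset_iff.2 hx))).ne'
    (measure_ne_top _ _)

variable [MeasurableSingletonClass E] [Fintype E]

open Classical in
theorem measureReal_eq_sum (μ : Measure E) [IsFiniteMeasure μ] (s : Set E) :
    μ.real s = ∑ y with y ∈ s, μ.real {y} := by
  rw [sum_measureReal_singleton]
  simp

open Classical in
theorem normalize_eq_cond_iff {μ ν : Measure E} [IsFiniteMeasure μ] [IsFiniteMeasure ν]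
    (hμ : 0 < μ.real Set.univ) {B : Set E} (hB : 0 < ν.real B) :
    (μ Set.univ)⁻¹ • μ = ν[|B] ↔
      ∀ z, μ.real {z} / μ.real Set.univ = if z ∈ B then ν.real {z} / ν.real B else 0 := by
  rw [Measure.ext_iff_singleton]
  refine forall_congr' fun z => ?_
  have hμ' : μ Set.univ ≠ 0 := fun h => by simp [Measure.real, h] at hμ
  have hB' : ν B ≠ 0 := fun h => by simp [Measure.real, h] at hB
  rw [cond_apply (Set.toFinite B).measurableSet, Measure.smul_apply, smul_eq_mul,
    ← ENNReal.toReal_eq_toReal_iff' (ENNReal.mul_ne_top (ENNReal.inv_ne_top.2 hμ') (by finiteness))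
      (ENNReal.mul_ne_top (ENNReal.inv_ne_top.2 hB') (by finiteness)),
    ENNReal.toReal_mul, ENNReal.toReal_mul, ENNReal.toReal_inv, ENNReal.toReal_inv,
    inv_mul_eq_div, inv_mul_eq_div]
  by_cases hz : z ∈ B
  · rw [if_pos hz, Set.inter_eq_right.2 (Set.singleton_subset_iff.2 hz)]
    rfl
  · rw [if_neg hz, Set.inter_singleton_eq_empty.2 hz]
    simp [Measure.real]

theorem cond_eq_self_iff {ν : Measure E} [IsFiniteMeasure ν] {B : Set E} (hB : 0 < ν.real B)
    (A : Set E) : ν[A | B] = ν A ↔ ν.real (B ∩ A) = ν.real B * ν.real A := by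
  have hB' : ν B ≠ 0 := fun h => by simp [Measure.real, h] at hB
  rw [cond_apply (Set.toFinite B).measurableSet,
    ← ENNReal.toReal_eq_toReal_iff' (ENNReal.mul_ne_top (ENNReal.inv_ne_top.2 hB') (by finiteness))
      (by finiteness),
    ENNReal.toReal_mul, ENNReal.toReal_inv, inv_mul_eq_div]
  change ν.real _ / ν.real _ = ν.real _ ↔ _
  rw [div_eq_iff hB.ne', mul_comm]

end Main

/-! ### The two implications. -/

section Partition

variable {Ω E : Type*} [MeasurableSpace Ω] [MeasurableSpace E] [MeasurableSingletonClass E]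
  [Fintype E]

theorem IsMVPS.isCID_of_partition {P : Measure Ω} [IsProbabilityMeasure P] {X : ℕ → Ω → E}
    {θ : ℝ} {ν : Measure E} {R : Kernel E E} (hX : IsMVPS P X θ ν R)
    (hR : StrictlyPositiveReinforcement ν R) (hν : ∀ x, 0 < ν {x}) {m : ℕ} {B : Fin m → Set E}
    (hB : IsPartitionInto B) (h1 : ∀ j, ∀ x ∈ B j, (R x Set.univ)⁻¹ • R x = ν[|B j])
    (h2 : ∀ j, ∀ a : ℝ, 0 < a →
      ν[{y | (R y).real Set.univ = a} | B j] = ν {y | (R y).real Set.univ = a}) :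
    IsCID P X := by
  classical
  have := hX.isProbabilityMeasure
  have := hX.finite_kernel
  have hw := hR.total_pos hν hX.finite_kernel
  have hBpos j : 0 < ν.real (B j) := measureReal_pos_of_nonempty hν (hB.nonempty j)
  have hcov : ∀ x, ∃ j, x ∈ B j := fun x => Set.mem_iUnion.1 (hB.cover ▸ Set.mem_univ x)
  choose b hb using hcov
  have hmem : ∀ x j, x ∈ B j ↔ b x = j := fun x j =>
    ⟨fun h => by
      by_contra hne
      exact Set.disjoint_left.1 (hB.disjoint _ _ hne) (hb x) h, fun h => h ▸ hb x⟩
  have hsum : ∀ j, ν.real (B j) = ∑ y with b y = j, ν.real {y} := fun j => by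
    rw [measureReal_eq_sum]
    simp_rw [hmem]
  rw [hX.isCID_iff_drift hν hw]
  intro n x z
  refine drift_eq_zero_of_partition b (w := fun y => (R y).real Set.univ)
    (ν := fun y => ν.real {y})
    (fun y => measureReal_pos_of_nonempty hν (Set.singleton_nonempty y)) (by simp) ?_ ?_ x z
  · intro x z
    have h := (normalize_eq_cond_iff (hw x) (hBpos (b x))).1 (h1 (b x) x (hb x)) z
    rw [replacement, h]
    simp only [hmem, eq_comm (a := b z)]
    split_ifs with h
    · rw [hsum, h]
    · rfl
  · intro j a
    by_cases ha : 0 < a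
    · have h := (cond_eq_self_iff (hBpos j) _).1 (h2 j a ha)
      rw [measureReal_eq_sum ν (_ ∩ _), hsum, measureReal_eq_sum ν {y | _}] at h
      simpa [hmem] using h
    -- No weight is nonpositive, so both sides are zero.
    · have hne : ∀ y, (R y).real Set.univ ≠ a := fun y h => ha (h ▸ hw y)
      simp [hne]

theorem IsMVPS.exists_partition_of_isCID {P : Measure Ω} [IsProbabilityMeasure P]
    {X : ℕ → Ω → E} {θ : ℝ} {ν : Measure E} {R : Kernel E E} (hX : IsMVPS P X θ ν R)
    (hR : StrictlyPositiveReinforcement ν R) (hν : ∀ x, 0 < ν {x}) (hcid : IsCID P X) :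
    ∃ m : ℕ, 1 ≤ m ∧ m ≤ Nat.card E ∧ ∃ B : Fin m → Set E, IsPartitionInto B ∧
      (∀ j, ∀ x ∈ B j, (R x Set.univ)⁻¹ • R x = ν[|B j]) ∧
      (∀ j, ∀ a : ℝ, 0 < a →
        ν[{y | (R y).real Set.univ = a} | B j] = ν {y | (R y).real Set.univ = a}) := by
  classical
  have := hX.isProbabilityMeasure
  have := hX.finite_kernel
  have hw := hR.total_pos hν hX.finite_kernel
  have hνpos y : 0 < ν.real {y} := measureReal_pos_of_nonempty hν (Set.singleton_nonempty y)
  have hν1 : ∑ y, ν.real {y} = 1 := by simp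
  set p := replacement R with hp
  have hp0 : ∀ x y, 0 ≤ p x y := fun x y => div_nonneg measureReal_nonneg measureReal_nonneg
  have hp1 : ∀ x, ∑ y, p x y = 1 := fun x => by
    simp only [hp, replacement, ← Finset.sum_div]
    rw [div_eq_one_iff_eq (hw x).ne']
    simp
  rw [hX.isCID_iff_drift hν hw] at hcid
  have hdrift : ∀ (k : E → ℕ) (z : E), drift (fun y => (R y).real Set.univ) p
      (composition θ (fun y => ν.real {y}) (fun y => (R y).real Set.univ) p fun x => k x)
      (totalMass θ (fun y => (R y).real Set.univ) fun x => k x) z = 0 := by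
    intro k z
    obtain ⟨n, x, hx⟩ := exists_path k
    have h := hcid n x z
    simp_rw [hx fun y => (R y).real Set.univ] at h
    rw [← h]
    congr 1
    funext z
    exact congrArg _ (hx fun y => (R y).real Set.univ * p y z).symm
  have hres := @sum_weight_eq_zero E _ θ hX.theta_pos _ _ p hνpos hν1 hw hdrift
  have hpp : ∀ x z, ∑ y, p x y * p y z = p x z := fun x z =>
    sum_mul_eq_of_sum_weight_eq_zero (hp1 x) fun x' =>
      -- The mixture `N` is the single row `p x`.
      hres (d := Pi.single x 1) (by simp) (fun z => by simp [Pi.single_apply]) x' z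
  obtain ⟨c, hc1, hc⟩ := exists_mixture (p := p) hX.theta_pos hνpos hν1 hw fun z => by
    simpa using hcid 0 Fin.elim0 z
  have hresν := hres hc1 hc
  have hνp : ∀ z, ∑ y, ν.real {y} * p y z = ν.real {z} := fun z =>
    sum_mul_eq_of_sum_weight_eq_zero hν1 fun x => hresν x z
  -- The blocks are the fibres of `p`, indexed by its distinct rows, hence at most `|E|` in number.
  let e := Finite.equivFin (Set.range p)
  let B : Fin (Nat.card (Set.range p)) → Set E := fun j => {x | p x = (e.symm j).1}
  have hBne : ∀ j, ∃ x, p x = (e.symm j).1 := fun j => (e.symm j).2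
  have hBeq : ∀ {j z}, z ∈ B j → B j = {y | p y = p z} := fun {j z} hz => by
    simp only [B, show p z = (e.symm j).1 from hz]
  have hBsum : ∀ {j z}, z ∈ B j → ν.real (B j) = ∑ y with p y = p z, ν.real {y} :=
    fun {j z} hz => by
      rw [hBeq hz, measureReal_eq_sum]
      simp only [Set.mem_ofPred_eq]
  have hBpos j : 0 < ν.real (B j) := measureReal_pos_of_nonempty hν (hBne j)
  have hE : Nonempty E := by
    obtain ⟨ω⟩ := P.nonempty_of_neZero
    exact ⟨X 0 ω⟩
  refine ⟨Nat.card (Set.range p), Nat.card_pos, Finite.card_range_le p, B,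
    ⟨hBne, ?_, ?_⟩, ?_, ?_⟩
  · intro i j hij
    refine Set.disjoint_left.2 fun x (hi : p x = _) (hj : p x = _) => hij ?_
    exact e.symm.injective (Subtype.ext (hi.symm.trans hj))
  · refine Set.eq_univ_of_forall fun x => Set.mem_iUnion.2 ⟨e ⟨p x, x, rfl⟩, ?_⟩
    exact (congrArg Subtype.val (e.symm_apply_apply ⟨p x, x, rfl⟩)).symm
  · intro j x hx
    refine (normalize_eq_cond_iff (hw x) (hBpos j)).2 fun z => ?_
    change p x z = _
    split_ifs with hz
    · rw [eq_div_iff (hBpos j).ne', mul_comm, hBsum hz]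
      convert sum_class_mul_row hνpos hp0 hp1 hpp hνp (x := x) (z := z) ?_
      rw [hBeq hz] at hx
      exact hx
    · refine row_eq_zero_of_ne hνpos hp0 hp1 hpp hνp fun h => hz ?_
      rw [hBeq hx]
      exact h.symm
  · intro j a ha
    refine (cond_eq_self_iff (hBpos j) _).2 ?_
    obtain ⟨z, hz⟩ := hBne j
    have hz : z ∈ B j := hz
    rw [measureReal_eq_sum ν (_ ∩ _), hBsum hz, measureReal_eq_sum ν {y | _}, hBeq hz]
    have h0 : ∑ y with (R y).real Set.univ = a, ν.real {y} * (p y z - ν.real {z}) = 0 := by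
      by_cases h : ∃ x, (R x).real Set.univ = a
      · obtain ⟨x, rfl⟩ := h
        exact hresν x z
      · rw [not_exists] at h
        simp [h]
    have h := weight_indep_class hνpos hp0 hp1 hpp hνp a z h0
    simp only [Set.mem_inter_iff, Set.mem_ofPred_eq]
    convert h

end Partition

end PolyaSequence

theorem mainTheorem4 {Ω E : Type*} [MeasurableSpace Ω] [Finite E] [MeasurableSpace E]
    [MeasurableSingletonClass E] (P : Measure Ω) [IsProbabilityMeasure P] (X : ℕ → Ω → E)
    (θ : ℝ) (ν : Measure E) (R : Kernel E E) (hX : PolyaSequence.IsMVPS P X θ ν R)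
    (hR : PolyaSequence.StrictlyPositiveReinforcement ν R) (hν : ∀ x, 0 < ν {x}) :
    PolyaSequence.IsCID P X ↔
      ∃ m : ℕ, 1 ≤ m ∧ m ≤ Nat.card E ∧ ∃ B : Fin m → Set E,
        PolyaSequence.IsPartitionInto B ∧
        (∀ j, ∀ x ∈ B j, (R x Set.univ)⁻¹ • R x = ν[|B j]) ∧
        (∀ j, ∀ a : ℝ, 0 < a →
          ν[{y | (R y).real Set.univ = a} | B j] = ν {y | (R y).real Set.univ = a}) := by
  cases nonempty_fintype E
  exact ⟨hX.exists_partition_of_isCID hR hν,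
    fun ⟨_, _, _, _, hB, h1, h2⟩ => hX.isCID_of_partition hR hν hB h1 h2⟩
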